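/- Let $\Gamma$ be a countable simplicial graph (no loops or multiple edges; the vertex set $V$ is finite or countably infinite) and let $(G_v)_{v\in V}$ be a collection of discrete groups. The graph product $\Gamma\mathfrak G$ is the quotient of the free product of the groups $G_v$ by the relations $[g,h]=1$ for all $g\in G_u$, $h\in G_v$ with $\{u,v\}$ an edge of $\Gamma$; it is given the discrete topology. Let scalars be real or complex. For $1\le p<\infty$, an $L_p$-space is a space $L_p(\Omega,\mu)$ for some measure space $(\Omega,\mu)$. An affine isometric action of a discrete group $G$ on a normed space $E$ is a homomorphism $g\mapsto\alpha(g)$ from $G$ to the group of maps $x\mapsto Ax+b$ of $E$ with $A$ a surjective linear isometry and $b\in E$; it is proper if for every $M>0$ and every $x\in E$ there is a finite set $F\subset G$ such that $\|\alpha(g)x\|>M$ for all $g\in G\setminus F$. A locally compact second countable group $G$ is Haagerup if it has a continuous affine isometric action $\alpha$ on a Hilbert space such that for every $M\ge 0$ there is a compact set $K\subset G$ with $\|\alpha(g)0\|\ge M$ for all $g\in G\setminus K$ (continuity is automatic when $G$ is discrete). Then: (1) For every $1\le p<\infty$, the group $\Gamma\mathfrak G$ admits a proper affine isometric action on an $L_p$-space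 if and only if every $G_v$, $v\in V$, admits a proper affine isometric action on an $L_p$-space. (2) If every $G_v$ has the Haagerup property, then $\Gamma\mathfrak G$ has the Haagerup property. -/

import Mathlib

open MeasureTheory
open scoped ENNReal

universe u v w

section GraphProducts

/-- The relators `[g, h] = g⁻¹ h⁻¹ g h` in the free product of the groups `G v`, where `g` and `h`
run over the vertex groups at the two ends of an edge of `Γ`. -/
def graphProductRelators {V : Type u} (Γ : SimpleGraph V) (G : V → Type v)
    [∀ x, Group (G x)] : Set (Monoid.CoprodI G) :=
  {r | ∃ x y : V, Γ.Adj x y ∧ ∃ (g : G x) (h : G y),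
    r = (Monoid.CoprodI.of g)⁻¹ * (Monoid.CoprodI.of h)⁻¹ *
      Monoid.CoprodI.of g * Monoid.CoprodI.of h}

/-- The graph product of the groups `G v` along the simplicial graph `Γ`: the free product of the
vertex groups modulo the normal subgroup generated by the commutators of elements of
adjacent vertex groups. -/
def GraphProduct {V : Type u} (Γ : SimpleGraph V) (G : V → Type v)
    [∀ x, Group (G x)] : Type (max u v) :=
  Monoid.CoprodI G ⧸ Subgroup.normalClosure (graphProductRelators Γ G)

instance GraphProduct.instGroup {V : Type u} (Γ : SimpleGraph V) (G : V → Type v)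
    [∀ x, Group (G x)] : Group (GraphProduct Γ G) :=
  inferInstanceAs
    (Group (Monoid.CoprodI G ⧸ Subgroup.normalClosure (graphProductRelators Γ G)))

end GraphProducts

section Actions

/-- An affine isometric action of a (discrete) group on a normed space `E` is a group
homomorphism into the affine isometries of `E`.  It is proper if for every `M > 0` and every
`x : E` all but finitely many group elements `g` satisfy `‖g • x‖ > M`. -/
def IsProperAffineAction {𝕜 : Type} [RCLike 𝕜] {E : Type w} [NormedAddCommGroup E]
    [NormedSpace 𝕜 E] {G : Type u} [Group G] (α : G →* (E ≃ᵃⁱ[𝕜] E)) : Prop :=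
  ∀ M : ℝ, 0 < M → ∀ x : E, ∃ F : Finset G, ∀ g : G, g ∉ F → M < ‖α g x‖

/-- The (discrete) group `G` admits a proper affine isometric action on an `L_p`-space, that is,
on `L_p(Ω, μ)` with scalars `𝕜` for some measure space `(Ω, μ)`. -/
def AdmitsProperAffineActionOnLp (𝕜 : Type) [RCLike 𝕜] (p : ℝ≥0∞) [Fact (1 ≤ p)]
    (G : Type u) [Group G] : Prop :=
  ∃ (Ω : Type w) (_ : MeasurableSpace Ω) (μ : Measure Ω)
    (α : G →* (Lp 𝕜 p μ ≃ᵃⁱ[𝕜] Lp 𝕜 p μ)), IsProperAffineAction α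

/-- The Haagerup property of a topological group: it is locally compact and second countable,
and it has a (continuous) affine isometric action on a Hilbert space for which
the orbit map of `0` is proper. For discrete groups the continuity is automatic. -/
def IsHaagerup (𝕜 : Type) [RCLike 𝕜] (G : Type u) [Group G] [TopologicalSpace G] : Prop :=
  IsTopologicalGroup G ∧ LocallyCompactSpace G ∧ SecondCountableTopology G ∧
    ∃ (H : Type w) (_ : NormedAddCommGroup H) (_ : InnerProductSpace 𝕜 H) (_ : CompleteSpace H)
      (α : G →* (H ≃ᵃⁱ[𝕜] H)),
      (∀ x : H, Continuous fun g : G => α g x) ∧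
      ∀ M : ℝ, 0 ≤ M → ∃ K : Set G, IsCompact K ∧ ∀ g : G, g ∉ K → M ≤ ‖α g 0‖

end Actions

/-! An action of the graph product restricts to each vertex group, which embeds because `proj` is a
left inverse of `of`.

For the other direction, fix a vertex `x` and an affine isometric action `α` of `G x` on `F`. The
graph product acts on the `ℓ^p`-sum of copies of `F` over the cosets of the star subgroup of `x`:
linearly, it permutes the cosets and acts on `F` through `proj`; in addition, a letter `a` at `x`
translates by `α a 0` placed over the base coset, and other letters do not translate. Two letters at
`x` in a geodesic word are separated by a word outside the star (`IsGeodesic.wordProd_notMem_star`),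
so their translations end up over different cosets. Hence the `p`-th power of the displacement of
the origin is the sum of `‖α a 0‖ ^ p` over the letters at `x` (`exists_inducedAction`).

Each vertex is used twice, once with its given proper action and once with an action moving the
origin far for every nontrivial element, at least `f x + 1` with `f : V → ℕ` injective. In the
`ℓ^p`-sum of all induced actions, a bound on the displacement leaves finitely many vertices,
finitely many letters at each, and bounded word length (`finite_of_weight_le`). Only closure of the
class of spaces under countable `ℓ^p`-sums is needed, which holds for `L^p`-spaces, and for Hilbert
spaces with `p = 2`. -/

namespace GraphProduct

/-! ### Words, retractions and star subgroups in graph products -/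

section

open scoped Classical

variable {V : Type u} {Γ : SimpleGraph V} {G : V → Type v} [∀ x, Group (G x)]

/-- The quotient map from the free product of the vertex groups. -/
def mk (Γ : SimpleGraph V) (G : V → Type v) [∀ x, Group (G x)] :
    Monoid.CoprodI G →* GraphProduct Γ G where
  toFun := QuotientGroup.mk' (Subgroup.normalClosure (graphProductRelators Γ G))
  map_one' := map_one (QuotientGroup.mk' (Subgroup.normalClosure (graphProductRelators Γ G)))
  map_mul' := map_mul (QuotientGroup.mk' (Subgroup.normalClosure (graphProductRelators Γ G)))

theorem mk_surjective : Function.Surjective (mk Γ G) :=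
  QuotientGroup.mk'_surjective _

/-- The inclusion of a vertex group into the graph product. -/
def of (Γ : SimpleGraph V) (x : V) : G x →* GraphProduct Γ G :=
  (mk Γ G).comp Monoid.CoprodI.of

theorem of_commute {x y : V} (h : Γ.Adj x y) (a : G x) (b : G y) :
    Commute (of Γ x a) (of Γ y b) := by
  have h1 : (Monoid.CoprodI.of a)⁻¹ * (Monoid.CoprodI.of b)⁻¹ *
      Monoid.CoprodI.of a * Monoid.CoprodI.of b ∈
        Subgroup.normalClosure (graphProductRelators Γ G) :=
    Subgroup.subset_normalClosure ⟨x, y, h, a, b, rfl⟩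
  have h2 : mk Γ G ((Monoid.CoprodI.of a)⁻¹ * (Monoid.CoprodI.of b)⁻¹ *
      Monoid.CoprodI.of a * Monoid.CoprodI.of b) = 1 :=
    (QuotientGroup.eq_one_iff _).2 h1
  have h3 : (of Γ y b * of Γ x a)⁻¹ * (of Γ x a * of Γ y b) = 1 := by
    simp only [map_mul, map_inv] at h2
    rw [mul_inv_rev, ← h2, of, of]
    simp only [MonoidHom.comp_apply, mul_assoc]
  exact (inv_mul_eq_one.1 h3).symm

/-- Homomorphisms on the vertex groups which commute along the edges extend to the graph
product. -/
theorem exists_lift {H : Type*} [Group H] (f : ∀ x, G x →* H)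
    (hf : ∀ x y, Γ.Adj x y → ∀ (a : G x) (b : G y), Commute (f x a) (f y b)) :
    ∃ F : GraphProduct Γ G →* H, ∀ x a, F (of Γ x a) = f x a := by
  have key : Subgroup.normalClosure (graphProductRelators Γ G) ≤
      (Monoid.CoprodI.lift f : Monoid.CoprodI G →* H).ker := by
    refine Subgroup.normalClosure_le_normal ?_
    rintro _ ⟨x, y, h, a, b, rfl⟩
    have := (hf x y h a b).eq
    simp only [SetLike.mem_coe, MonoidHom.mem_ker, map_mul, map_inv, Monoid.CoprodI.lift_of]
    rw [mul_assoc, this]; group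
  let F := QuotientGroup.lift _ (Monoid.CoprodI.lift f : Monoid.CoprodI G →* H) key
  exact ⟨{ toFun := F, map_one' := map_one F, map_mul' := map_mul F },
    fun x a => Monoid.CoprodI.lift_of f a⟩

/-- The universal property of the graph product. -/
noncomputable def lift {H : Type*} [Group H] (f : ∀ x, G x →* H)
    (hf : ∀ x y, Γ.Adj x y → ∀ (a : G x) (b : G y), Commute (f x a) (f y b)) :
    GraphProduct Γ G →* H :=
  (exists_lift f hf).choose

@[simp]
theorem lift_of {H : Type*} [Group H] (f : ∀ x, G x →* H)
    (hf : ∀ x y, Γ.Adj x y → ∀ (a : G x) (b : G y), Commute (f x a) (f y b)) (x : V) (a : G x) :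
    lift f hf (of Γ x a) = f x a :=
  (exists_lift f hf).choose_spec x a

/-- The element of the graph product represented by a word in the vertex groups. -/
def wordProd (Γ : SimpleGraph V) (l : List (Σ x, G x)) : GraphProduct Γ G :=
  (l.map fun s => of Γ s.1 s.2).prod

@[simp]
theorem wordProd_nil : wordProd Γ ([] : List (Σ x, G x)) = 1 := rfl

@[simp]
theorem wordProd_cons (s : Σ x, G x) (l : List (Σ x, G x)) :
    wordProd Γ (s :: l) = of Γ s.1 s.2 * wordProd Γ l := by simp [wordProd]

@[simp]
theorem wordProd_append (l m : List (Σ x, G x)) :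
    wordProd Γ (l ++ m) = wordProd Γ l * wordProd Γ m := by simp [wordProd]

theorem wordProd_surjective :
    Function.Surjective (wordProd Γ : List (Σ x, G x) → GraphProduct Γ G) := by
  intro g
  obtain ⟨m, rfl⟩ := mk_surjective g
  induction m using Monoid.CoprodI.induction_on with
  | one => exact ⟨[], by simp⟩
  | of x a => exact ⟨[⟨x, a⟩], by simp [of]⟩
  | mul a b ha hb =>
    obtain ⟨l, hl⟩ := ha
    obtain ⟨m, hm⟩ := hb
    exact ⟨l ++ m, by rw [wordProd_append, hl, hm, map_mul]⟩

instance [Countable V] [∀ x, Countable (G x)] : Countable (GraphProduct Γ G) :=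
  wordProd_surjective.countable

/-- The projection onto a vertex group which kills all the others. -/
noncomputable def proj (Γ : SimpleGraph V) (x : V) : GraphProduct Γ G →* G x :=
  lift (fun y => (Pi.evalMonoidHom G x).comp (MonoidHom.mulSingle G y)) fun _ _ h a b =>
    (Pi.mulSingle_commute h.ne a b).map (Pi.evalMonoidHom G x)

@[simp]
theorem proj_of_self (x : V) (a : G x) : proj Γ x (of Γ x a) = a :=
  (lift_of _ _ x a).trans (Pi.mulSingle_eq_same x a)

theorem proj_of_ne {x y : V} (h : y ≠ x) (a : G y) : proj Γ x (of Γ y a) = 1 :=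
  (lift_of _ _ y a).trans (Pi.mulSingle_eq_of_ne h.symm a)

theorem of_injective (x : V) : Function.Injective (of Γ x : G x →* GraphProduct Γ G) :=
  Function.LeftInverse.injective (proj_of_self x)

/-- The retraction onto the subgroup generated by the vertex groups in `S` which kills the other
vertex groups. -/
noncomputable def retract (Γ : SimpleGraph V) (G : V → Type v) [∀ x, Group (G x)] (S : Set V) :
    GraphProduct Γ G →* GraphProduct Γ G :=
  lift (fun x => if x ∈ S then of Γ x else 1) fun x y h a b => by
    split_ifs <;> simp [of_commute h]

theorem retract_of (S : Set V) (x : V) (a : G x) :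
    retract Γ G S (of Γ x a) = if x ∈ S then of Γ x a else 1 := by
  rw [retract, lift_of]; split_ifs <;> rfl

theorem retract_wordProd (S : Set V) (l : List (Σ x, G x)) :
    retract Γ G S (wordProd Γ l) = wordProd Γ (l.filter fun s => s.1 ∈ S) := by
  induction l with
  | nil => simp
  | cons s l ih =>
    rw [wordProd_cons, map_mul, retract_of, ih, List.filter_cons]
    by_cases h : s.1 ∈ S <;> simp [h]

/-- The subgroup generated by the vertex groups in the star of a vertex, described as the set of
fixed points of the corresponding retraction. -/
noncomputable def star (Γ : SimpleGraph V) (G : V → Type v) [∀ x, Group (G x)] (x : V) :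
    Subgroup (GraphProduct Γ G) :=
  (retract Γ G {y | y = x ∨ Γ.Adj x y}).eqLocus (MonoidHom.id _)

theorem mem_star_iff {x : V} {g : GraphProduct Γ G} :
    g ∈ star Γ G x ↔ retract Γ G {y | y = x ∨ Γ.Adj x y} g = g := Iff.rfl

theorem of_mem_star {x y : V} (h : y = x ∨ Γ.Adj x y) (a : G y) : of Γ y a ∈ star Γ G x := by
  rw [mem_star_iff, retract_of]; exact if_pos h

/-- A word is geodesic if no shorter word represents the same element. -/
def IsGeodesic (Γ : SimpleGraph V) (l : List (Σ x, G x)) : Prop :=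
  ∀ m : List (Σ x, G x), wordProd Γ m = wordProd Γ l → l.length ≤ m.length

theorem exists_isGeodesic (g : GraphProduct Γ G) :
    ∃ l : List (Σ x, G x), IsGeodesic Γ l ∧ wordProd Γ l = g := by
  have h : {l : List (Σ x, G x) | wordProd Γ l = g}.Nonempty := wordProd_surjective g
  obtain ⟨l, hl, hmin⟩ := exists_minimal_of_wellFoundedLT
    (fun n => ∃ l : List (Σ x, G x), l.length = n ∧ wordProd Γ l = g)
    (let ⟨l, hl⟩ := h; ⟨l.length, l, rfl, hl⟩)
  obtain ⟨l, rfl, rfl⟩ := hl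
  refine ⟨l, fun m hm => ?_, rfl⟩
  rcases le_total l.length m.length with h | h
  · exact h
  · exact hmin ⟨m, rfl, hm⟩ h

/-- A shorter replacement for the middle segment would shorten the whole word. -/
theorem IsGeodesic.of_append {l m n : List (Σ x, G x)} (h : IsGeodesic Γ (l ++ m ++ n)) :
    IsGeodesic Γ m := by
  intro m' hm
  have := h (l ++ m' ++ n) (by simp [hm])
  simp only [List.length_append] at this
  omega

theorem IsGeodesic.tail {s : Σ x, G x} {l : List (Σ x, G x)} (h : IsGeodesic Γ (s :: l)) :
    IsGeodesic Γ l :=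
  IsGeodesic.of_append (l := [s]) (n := []) (by simpa using h)

theorem IsGeodesic.ne_one {l : List (Σ x, G x)} (h : IsGeodesic Γ l) {s : Σ x, G x}
    (hs : s ∈ l) : s.2 ≠ 1 := by
  intro h1
  obtain ⟨m, n, rfl⟩ := List.append_of_mem hs
  have := h (m ++ n) (by simp [h1])
  simp at this

/-- In a word in the star of `x`, the letters at `x` can be collected at the front. -/
theorem wordProd_of_forall_mem_star (x : V) (l : List (Σ x, G x))
    (h : ∀ s ∈ l, s.1 = x ∨ Γ.Adj x s.1) :
    wordProd Γ l =
      of Γ x (proj Γ x (wordProd Γ l)) * wordProd Γ (l.filter fun s => s.1 ≠ x) := by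
  induction l with
  | nil => simp
  | cons s l ih =>
    have ih := ih fun t ht => h t (List.mem_cons_of_mem _ ht)
    obtain ⟨y, a⟩ := s
    by_cases hy : y = x
    · subst hy
      rw [List.filter_cons_of_neg (by simp), wordProd_cons, map_mul, map_mul, proj_of_self,
        mul_assoc, ← ih]
    · have hadj : Γ.Adj x y := (h ⟨y, a⟩ List.mem_cons_self).resolve_left hy
      rw [List.filter_cons_of_pos (by simpa using hy), wordProd_cons, map_mul, proj_of_ne hy,
        one_mul, wordProd_cons, ← mul_assoc, (of_commute hadj _ _).eq, mul_assoc, ← ih]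

/-- Two letters of a geodesic word at the same vertex are separated by a word which does not
represent an element of the star subgroup. -/
theorem IsGeodesic.wordProd_notMem_star {x : V} {a b : G x} {l m : List (Σ x, G x)}
    (h : IsGeodesic Γ (⟨x, a⟩ :: (l ++ ⟨x, b⟩ :: m))) : wordProd Γ l ∉ star Γ G x := by
  intro hl
  have h1 : IsGeodesic Γ (⟨x, a⟩ :: (l ++ [⟨x, b⟩])) :=
    IsGeodesic.of_append (l := []) (n := m) (by simpa using h)
  have h2 : IsGeodesic Γ l :=
    IsGeodesic.of_append (l := [⟨x, a⟩]) (n := [⟨x, b⟩]) (by simpa using h1)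
  -- The retraction deletes the letters outside the star. As it fixes the element and `l` is
  -- geodesic, nothing is deleted.
  rw [mem_star_iff, retract_wordProd] at hl
  have h3 : ∀ s ∈ l, s.1 = x ∨ Γ.Adj x s.1 := by
    have := List.length_filter_eq_length_iff.1
      (le_antisymm (List.length_filter_le _ _) (h2 _ hl))
    intro s hs
    simpa using this s hs
  have h4 := wordProd_of_forall_mem_star (Γ := Γ) x (⟨x, a⟩ :: (l ++ [⟨x, b⟩])) (by
    intro s hs
    simp only [List.mem_cons, List.mem_append, List.not_mem_nil, or_false] at hs
    rcases hs with rfl | hs | rfl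
    · exact Or.inl rfl
    · exact h3 s hs
    · exact Or.inl rfl)
  -- Collecting the letters at `x` merges `a` and `b` into one letter, which makes the word strictly
  -- shorter.
  have h5 := h1 (⟨x, _⟩ :: _) ((wordProd_cons _ _).trans h4.symm)
  have h6 := List.length_filter_le (fun s : Σ x, G x => decide (s.1 ≠ x)) l
  rw [List.filter_cons_of_neg (by simp), List.filter_append,
    List.filter_cons_of_neg (by simp)] at h5
  simp only [List.length_cons, List.length_append, List.length_nil, List.filter_nil] at h5
  omega

end

end GraphProduct

/-! ### Affine isometric actions as linear parts with cocycles -/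

section AffineActions

variable {𝕜 : Type*} [RCLike 𝕜] {E : Type*} [NormedAddCommGroup E] [NormedSpace 𝕜 E]
  {H : Type*} [Group H]

/-- The affine isometric action with a given linear part and a given cocycle. -/
noncomputable def affineAction (π : H →* (E ≃ₗᵢ[𝕜] E)) (b : H → E)
    (hb : ∀ g h, b (g * h) = b g + π g (b h)) : H →* (E ≃ᵃⁱ[𝕜] E) :=
  MonoidHom.mk' (fun g => AffineIsometryEquiv.constVAdd 𝕜 E (b g) * (π g).toAffineIsometryEquiv)
    fun g h => by
      ext x
      simp [hb, add_assoc]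

theorem affineAction_apply (π : H →* (E ≃ₗᵢ[𝕜] E)) (b : H → E)
    (hb : ∀ g h, b (g * h) = b g + π g (b h)) (g : H) (x : E) :
    affineAction π b hb g x = b g + π g x := by
  simp [affineAction]

/-- The linear part of an affine isometric action. -/
noncomputable def linearPart (α : H →* (E ≃ᵃⁱ[𝕜] E)) : H →* (E ≃ₗᵢ[𝕜] E) :=
  MonoidHom.mk' (fun g => (α g).linearIsometryEquiv) fun g h => by
    ext x
    have h1 := (α (g * h)).map_vsub x 0
    have h2 := (α h).map_vsub x 0
    have h3 := (α g).map_vsub (α h x) (α h 0)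
    simp only [vsub_eq_sub, sub_zero] at h1 h2 h3
    rw [LinearIsometryEquiv.coe_mul, Function.comp_apply, h1, h2, h3, map_mul]
    simp

theorem apply_eq_add_linearPart (α : H →* (E ≃ᵃⁱ[𝕜] E)) (g : H) (x : E) :
    α g x = α g 0 + linearPart α g x := by
  have h1 := (α g).map_vsub x 0
  simp only [vsub_eq_sub, sub_zero] at h1
  change α g x = α g 0 + (α g).linearIsometryEquiv x
  rw [h1]; abel

theorem affineAction_cocycle (α : H →* (E ≃ᵃⁱ[𝕜] E)) (g h : H) :
    α (g * h) 0 = α g 0 + linearPart α g (α h 0) := by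
  rw [map_mul, ← apply_eq_add_linearPart]; simp

/-- The orbits of `x` and `0` stay at distance `‖x‖`, so properness need only be checked at the
origin. -/
theorem norm_sub_norm_le_norm_affineAction (α : H →* (E ≃ᵃⁱ[𝕜] E)) (g : H) (x : E) :
    ‖α g 0‖ - ‖x‖ ≤ ‖α g x‖ := by
  have := (α g).dist_map x 0
  rw [dist_eq_norm, dist_zero_right] at this
  have h2 := norm_sub_norm_le (α g 0) (α g x)
  rw [norm_sub_rev, this] at h2
  linarith

end AffineActions

/-! ### Isometric representations and affine actions on `ℓ^p`-sums -/

section LpSums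

variable {𝕜 : Type*} [RCLike 𝕜] {p : ℝ≥0∞} [Fact (1 ≤ p)] {H : Type*} [Group H]

theorem toReal_pos_of_ne_top (hp : p ≠ ∞) : 0 < p.toReal :=
  ENNReal.toReal_pos (zero_lt_one.trans_le (Fact.out : 1 ≤ p)).ne' hp

/-- A family of isometries between the summands induces an isometry between the `ℓ^p`-sums. -/
noncomputable def lpCongr {I : Type*} {E F : I → Type*} [∀ i, NormedAddCommGroup (E i)]
    [∀ i, NormedSpace 𝕜 (E i)] [∀ i, NormedAddCommGroup (F i)] [∀ i, NormedSpace 𝕜 (F i)]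
    (e : ∀ i, E i ≃ₗᵢ[𝕜] F i) : lp E p ≃ₗᵢ[𝕜] lp F p where
  toFun f := ⟨fun i => e i (f i), by
    refine memℓp_norm_iff.1 ?_
    simpa using memℓp_norm_iff.2 (lp.memℓp f)⟩
  invFun f := ⟨fun i => (e i).symm (f i), by
    refine memℓp_norm_iff.1 ?_
    simpa using memℓp_norm_iff.2 (lp.memℓp f)⟩
  map_add' f g := lp.ext (funext fun i => map_add (e i) (f i) (g i))
  map_smul' c f := lp.ext (funext fun i => map_smul (e i) c (f i))
  left_inv f := by ext i; simp
  right_inv f := by ext i; simp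
  norm_map' f := by
    rw [← lp.norm_toNorm, ← lp.norm_toNorm (x := f)]
    congr 1
    ext i
    simp [lp.toNorm]

/-- The direct sum of a family of isometric representations. -/
noncomputable def lpRep {I : Type*} {E : I → Type*} [∀ i, NormedAddCommGroup (E i)]
    [∀ i, NormedSpace 𝕜 (E i)] (π : ∀ i, H →* (E i ≃ₗᵢ[𝕜] E i)) : H →* (lp E p ≃ₗᵢ[𝕜] lp E p) :=
  MonoidHom.mk' (fun g => lpCongr fun i => π i g) fun g h => by
    ext f i
    change π i (g * h) (f i) = π i g (π i h (f i))
    simp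

variable {K : Type*} {F : Type*} [NormedAddCommGroup F] [NormedSpace 𝕜 F]

theorem Memℓp.comp_equiv (hp : p ≠ ∞) {f : K → F} (hf : Memℓp f p) (σ : Equiv.Perm K) :
    Memℓp (f ∘ σ) p := by
  rw [memℓp_gen_iff (toReal_pos_of_ne_top hp)] at hf ⊢
  exact (σ.summable_iff (f := fun k => ‖f k‖ ^ p.toReal)).2 hf

variable (𝕜 F) in
/-- A permutation of the index set induces an isometry of an `ℓ^p`-space. -/
noncomputable def lpPerm (hp : p ≠ ∞) (σ : Equiv.Perm K) :
    lp (fun _ : K => F) p ≃ₗᵢ[𝕜] lp (fun _ : K => F) p where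
  toFun f := ⟨f ∘ σ.symm, (lp.memℓp f).comp_equiv hp σ.symm⟩
  invFun f := ⟨f ∘ σ, (lp.memℓp f).comp_equiv hp σ⟩
  map_add' _ _ := rfl
  map_smul' _ _ := rfl
  left_inv f := by ext i; simp
  right_inv f := by ext i; simp
  norm_map' f := by
    have h := toReal_pos_of_ne_top hp
    rw [lp.norm_eq_tsum_rpow h, lp.norm_eq_tsum_rpow h]
    congr 1
    exact σ.symm.tsum_eq fun k => ‖f k‖ ^ p.toReal

/-- The tensor product of a permutation representation on `ℓ^p` and an isometric representation. -/
noncomputable def permRep (hp : p ≠ ∞) (σ : H →* Equiv.Perm K) (π : H →* (F ≃ₗᵢ[𝕜] F)) :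
    H →* (lp (fun _ : K => F) p ≃ₗᵢ[𝕜] lp (fun _ : K => F) p) :=
  MonoidHom.mk' (fun g => lpPerm 𝕜 F hp (σ g) * lpRep (fun _ => π) g) fun g h => by
    ext f k
    change π (g * h) (f ((σ (g * h)).symm k)) =
      π g (π h (f ((σ h).symm ((σ g).symm k))))
    rw [map_mul, map_mul]
    rfl

theorem permRep_apply (hp : p ≠ ∞) (σ : H →* Equiv.Perm K) (π : H →* (F ≃ₗᵢ[𝕜] F)) (g : H)
    (f : lp (fun _ : K => F) p) (k : K) :
    permRep hp σ π g f k = π g (f ((σ g)⁻¹ k)) := rfl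

open scoped Classical in
theorem permRep_single (hp : p ≠ ∞) (σ : H →* Equiv.Perm K) (π : H →* (F ≃ₗᵢ[𝕜] F)) (g : H)
    (k : K) (x : F) :
    permRep hp σ π g (lp.single p k x) = lp.single p (σ g k) (π g x) := by
  ext j
  rw [permRep_apply]
  by_cases h : j = σ g k
  · subst h
    simp
  · rw [lp.single_apply_ne _ _ _ h, lp.single_apply_ne, map_zero]
    rintro rfl
    simp at h

-- Vectors with disjoint supports have additive `p`-th powers of norms; this produces the sum over
-- letters in `exists_inducedAction`.
open scoped Classical in
theorem norm_single_add_rpow (hp : p ≠ ∞) (k : K) (x : F) (f : lp (fun _ : K => F) p)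
    (hf : f k = 0) :
    ‖lp.single p k x + f‖ ^ p.toReal = ‖x‖ ^ p.toReal + ‖f‖ ^ p.toReal := by
  have h := lp.norm_sub_norm_compl_sub_single (toReal_pos_of_ne_top hp) (lp.single p k x + f) {k}
  simp [hf] at h
  linarith

/-- The direct sum of a family of affine isometric actions. -/
theorem exists_affineAction_lp {I : Type*} {E : I → Type*} [∀ i, NormedAddCommGroup (E i)]
    [∀ i, NormedSpace 𝕜 (E i)] (α : ∀ i, H →* (E i ≃ᵃⁱ[𝕜] E i))
    (hα : ∀ g, Memℓp (fun i => α i g 0) p) :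
    ∃ β : H →* (lp E p ≃ᵃⁱ[𝕜] lp E p), ∀ g i, β g 0 i = α i g 0 := by
  refine ⟨affineAction (lpRep fun i => linearPart (α i)) (fun g => ⟨fun i => α i g 0, hα g⟩) ?_,
    fun g i => ?_⟩
  · intro g h
    ext i
    exact affineAction_cocycle (α i) g h
  · rw [affineAction_apply, map_zero, add_zero]

open scoped Classical in
/-- A group acts on the `ℓ^p`-sum indexed by itself in such a way that all nontrivial elements
move the origin by at least a given amount. -/
theorem exists_affineAction_norm_le (𝕜 : Type*) [RCLike 𝕜] [NormedSpace 𝕜 F] (hp : p ≠ ∞)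
    (e : K ≃ H) (x : F) :
    ∃ β : H →* (lp (fun _ : K => F) p ≃ᵃⁱ[𝕜] lp (fun _ : K => F) p),
      ∀ g, g ≠ 1 → ‖x‖ ≤ ‖β g 0‖ := by
  let σ : H →* Equiv.Perm K :=
    e.symm.permCongrHom.toMonoidHom.comp (MulAction.toPermHom H H)
  have hσ : ∀ g, σ g (e.symm 1) = e.symm g := fun g => by simp [σ]
  let π := permRep (𝕜 := 𝕜) (F := F) hp σ 1
  -- The cocycle is the coboundary of the point mass `x` at the identity. For `g ≠ 1` the translated
  -- mass sits elsewhere, so the coordinate at `g` alone has norm `‖x‖`.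
  refine ⟨affineAction π (fun g => π g (lp.single p (e.symm 1) x) - lp.single p (e.symm 1) x) ?_,
    fun g hg => ?_⟩
  · intro g h
    rw [map_mul, LinearIsometryEquiv.coe_mul, Function.comp_apply, map_sub]
    abel
  · rw [affineAction_apply, map_zero, add_zero, permRep_single, hσ]
    refine le_trans (le_of_eq ?_)
      (lp.norm_apply_le_norm (zero_lt_one.trans_le (Fact.out : 1 ≤ p)).ne' _ (e.symm g))
    rw [lp.coeFn_sub, Pi.sub_apply, lp.single_apply_self, lp.single_apply_ne _ _ _
      (fun h => hg (e.symm.injective h)), sub_zero]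
    rfl

end LpSums

/-! ### The action induced from a vertex group -/

section Induced

variable {𝕜 : Type*} [RCLike 𝕜] {p : ℝ≥0∞} [Fact (1 ≤ p)]

open scoped Classical in
open GraphProduct in
/-- An affine isometric action of a vertex group induces an action of the graph product on the
`ℓ^p`-sum over the cosets of the star subgroup, with an explicit displacement of the origin. -/
theorem exists_inducedAction (hp : p ≠ ∞) {V : Type u} (Γ : SimpleGraph V) {G : V → Type v}
    [∀ x, Group (G x)] (x : V) {F : Type*} [NormedAddCommGroup F] [NormedSpace 𝕜 F]
    (α : G x →* (F ≃ᵃⁱ[𝕜] F)) {K : Type*} (e : K ≃ GraphProduct Γ G ⧸ star Γ G x) :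
    ∃ β : GraphProduct Γ G →* (lp (fun _ : K => F) p ≃ᵃⁱ[𝕜] lp (fun _ : K => F) p),
      ∀ l : List (Σ y, G y), IsGeodesic Γ l → ‖β (wordProd Γ l) 0‖ ^ p.toReal =
        (l.map fun s => ‖α (proj Γ x (of Γ s.1 s.2)) 0‖ ^ p.toReal).sum := by
  let σ : GraphProduct Γ G →* Equiv.Perm K :=
    e.symm.permCongrHom.toMonoidHom.comp
      (MulAction.toPermHom (GraphProduct Γ G) (GraphProduct Γ G ⧸ star Γ G x))
  have hσ : ∀ w k, e (σ w k) = w • e k := fun w k => by simp [σ]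
  let k₀ : K := e.symm (1 : GraphProduct Γ G)
  have hek₀ : e k₀ = ((1 : GraphProduct Γ G) : GraphProduct Γ G ⧸ star Γ G x) := by simp [k₀]
  have hk₀ : ∀ y, (y = x ∨ Γ.Adj x y) → ∀ a : G y, σ (of Γ y a) k₀ = k₀ := by
    intro y hy a
    apply e.injective
    rw [hσ, hek₀]
    refine QuotientGroup.eq.2 ?_
    simpa using inv_mem (of_mem_star hy a)
  let π := permRep (𝕜 := 𝕜) (F := F) hp σ ((linearPart α).comp (proj Γ x))
  let b : ∀ y, G y → lp (fun _ : K => F) p :=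
    fun y a => lp.single p k₀ (α (proj Γ x (of Γ y a)) 0)
  have hb0 : ∀ y, y ≠ x → ∀ a : G y, b y a = 0 := by
    intro y hy a
    simp only [b, proj_of_ne hy, map_one]
    simp
  have hπb : ∀ y, (y = x ∨ Γ.Adj x y) → ∀ (a : G y) (v : F),
      π (of Γ y a) (lp.single p k₀ v) =
        lp.single p k₀ (linearPart α (proj Γ x (of Γ y a)) v) := by
    intro y hy a v
    rw [permRep_single, hk₀ y hy]
    rfl
  have hb : ∀ y (a c : G y), b y (a * c) = b y a + (π.comp (of Γ y)) a (b y c) := by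
    intro y a c
    by_cases hy : y = x
    · rw [MonoidHom.comp_apply, hπb y (Or.inl hy)]
      simp only [b]
      rw [map_mul, map_mul, affineAction_cocycle, lp.single_add]
    · simp [hb0 y hy]
  have hadj : ∀ y, Γ.Adj x y → ∀ (a : G y) (c : G x), π (of Γ y a) (b x c) = b x c := by
    intro y hy a c
    rw [hπb y (Or.inr hy), proj_of_ne hy.ne', map_one]
    rfl
  -- This is the cocycle form of the commutation relation. It holds because a letter adjacent to `x`
  -- fixes the base coset and is killed by `proj`, hence fixes `b x c`.
  have hcross : ∀ y z, Γ.Adj y z → ∀ (a : G y) (c : G z),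
      b y a + π (of Γ y a) (b z c) = b z c + π (of Γ z c) (b y a) := by
    intro y z h a c
    by_cases hy : y = x
    · subst hy
      rw [hb0 z h.ne', hadj z h, map_zero, add_comm]
    · rw [hb0 y hy]
      by_cases hz : z = x
      · subst hz
        rw [hadj y h.symm, map_zero, add_comm]
      · rw [hb0 z hz]; simp
  let β : GraphProduct Γ G →* (lp (fun _ : K => F) p ≃ᵃⁱ[𝕜] lp (fun _ : K => F) p) :=
    lift (fun y => affineAction (π.comp (of Γ y)) (b y) (hb y)) fun y z h a c => by
      ext1 f
      have hcomm : π (of Γ y a) (π (of Γ z c) f) = π (of Γ z c) (π (of Γ y a) f) := by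
        have := congrArg (fun g => π g f) (of_commute h a c).eq
        simpa only [map_mul, LinearIsometryEquiv.coe_mul, Function.comp_apply] using this
      simp only [AffineIsometryEquiv.coe_mul, Function.comp_apply, affineAction_apply,
        MonoidHom.comp_apply, map_add]
      rw [← add_assoc, ← add_assoc, hcross y z h, hcomm]
  have hof : ∀ y (a : G y),
      β (of Γ y a) = affineAction (π.comp (of Γ y)) (b y) (hb y) a := lift_of _ _
  have hβ : ∀ y (a : G y) (g : GraphProduct Γ G),
      β (of Γ y a * g) 0 = b y a + π (of Γ y a) (β g 0) := by
    intro y a g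
    rw [map_mul, AffineIsometryEquiv.coe_mul, Function.comp_apply, hof,
      affineAction_apply, MonoidHom.comp_apply]
  have hβ1 : β 1 0 = 0 := by simp
  -- The displacement lives over the cosets of the prefixes that precede letters at `x`.
  have hsupp : ∀ (l : List (Σ y, G y)) (k : K), β (wordProd Γ l) 0 k ≠ 0 →
      ∃ l₁ c l₂, l = l₁ ++ ⟨x, c⟩ :: l₂ ∧ e k = (wordProd Γ l₁ : GraphProduct Γ G) := by
    intro l
    induction l with
    | nil =>
      intro k hk
      rw [wordProd_nil, hβ1] at hk
      exact absurd rfl hk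
    | cons s l ih =>
      obtain ⟨y, a⟩ := s
      intro k hk
      rw [wordProd_cons, hβ, lp.coeFn_add, Pi.add_apply] at hk
      by_cases hbk : b y a k = 0
      · rw [hbk, zero_add, permRep_apply] at hk
        obtain ⟨l₁, c, l₂, rfl, h⟩ := ih ((σ (of Γ y a))⁻¹ k) fun h0 => by
          rw [h0, map_zero] at hk
          exact hk rfl
        refine ⟨⟨y, a⟩ :: l₁, c, l₂, rfl, ?_⟩
        rw [← map_inv, hσ, inv_smul_eq_iff] at h
        rw [h, wordProd_cons]
        rfl
      · have hy : y = x := by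
          by_contra hy
          rw [hb0 y hy] at hbk
          exact hbk rfl
        subst hy
        have hkk : k = k₀ := by
          by_contra hkk
          exact hbk (lp.single_apply_ne _ _ _ hkk)
        exact ⟨[], a, l, rfl, by rw [hkk, hek₀, wordProd_nil]⟩
  refine ⟨β, fun l => ?_⟩
  induction l with
  | nil =>
    intro _
    rw [wordProd_nil, hβ1, norm_zero, Real.zero_rpow (toReal_pos_of_ne_top hp).ne']
    rfl
  | cons s l ih =>
    obtain ⟨y, a⟩ := s
    intro hl
    rw [wordProd_cons, hβ, List.map_cons, List.sum_cons, ← ih hl.tail,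
      ← (π (of Γ y a)).norm_map (β (wordProd Γ l) 0)]
    by_cases hy : y = x
    · subst hy
      refine norm_single_add_rpow hp k₀ _ _ ?_
      -- An overlap at the base coset would put the prefix between `a` and a later letter at `x`
      -- into the star, contradicting geodesicity.
      by_contra hne
      rw [permRep_apply] at hne
      obtain ⟨l₁, c, l₂, rfl, h⟩ := hsupp l ((σ (of Γ y a))⁻¹ k₀) fun h0 => by
        rw [h0, map_zero] at hne
        exact hne rfl
      rw [← map_inv, ← map_inv, hk₀ y (Or.inl rfl), hek₀] at h
      refine hl.wordProd_notMem_star ?_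
      simpa using QuotientGroup.eq.1 h
    · rw [hb0 y hy, zero_add, proj_of_ne hy, map_one, AffineIsometryEquiv.coe_one, id, norm_zero,
        Real.zero_rpow (toReal_pos_of_ne_top hp).ne', zero_add]

end Induced

/-! ### `L^p` of a disjoint union as an `ℓ^p`-sum -/

section LpSigma

variable {I : Type*} {Ω : I → Type*} [∀ i, MeasurableSpace (Ω i)]

theorem measurableEmbedding_sigmaMk (i : I) : MeasurableEmbedding (Sigma.mk i : Ω i → Sigma Ω) where
  injective := sigma_mk_injective
  measurable := fun _ hs => (MeasurableSpace.measurableSet_iInf.1 hs) i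
  measurableSet_image' := fun s hs => by
    refine MeasurableSpace.measurableSet_iInf.2 fun j => ?_
    change MeasurableSet (Sigma.mk j ⁻¹' (Sigma.mk i '' s))
    by_cases h : i = j
    · subst h
      rwa [Set.preimage_image_eq _ sigma_mk_injective]
    · rw [Set.preimage_image_sigmaMk_of_ne (Ne.symm h)]
      exact MeasurableSet.empty

/-- The disjoint union of a family of measures. -/
noncomputable def sigmaMeasure (μ : ∀ i, Measure (Ω i)) : Measure (Sigma Ω) :=
  Measure.sum fun i => (μ i).map (Sigma.mk i)

variable {μ : ∀ i, Measure (Ω i)}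

theorem ae_sigmaMeasure_iff [Countable I] {P : Sigma Ω → Prop} :
    (∀ᵐ x ∂sigmaMeasure μ, P x) ↔ ∀ i, ∀ᵐ x ∂μ i, P ⟨i, x⟩ := by
  rw [sigmaMeasure, Measure.ae_sum_iff]
  exact forall_congr' fun i => (measurableEmbedding_sigmaMk i).ae_map_iff

variable {E : Type*} [NormedAddCommGroup E] {p : ℝ≥0∞}

theorem aestronglyMeasurable_sigmaMeasure_iff [Countable I] {f : Sigma Ω → E} :
    AEStronglyMeasurable f (sigmaMeasure μ) ↔
      ∀ i, AEStronglyMeasurable (fun x => f ⟨i, x⟩) (μ i) := by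
  rw [sigmaMeasure, aestronglyMeasurable_sum_measure_iff]
  exact forall_congr' fun i => (measurableEmbedding_sigmaMk i).aestronglyMeasurable_map_iff

theorem eLpNorm_rpow_toReal {α : Type*} [MeasurableSpace α] (h0 : p ≠ 0) (hp : p ≠ ∞) (g : α → E)
    (ν : Measure α) : eLpNorm g p ν ^ p.toReal = ∫⁻ x, ‖g x‖ₑ ^ p.toReal ∂ν := by
  rw [eLpNorm_eq_lintegral_rpow_enorm_toReal h0 hp, ← ENNReal.rpow_mul, one_div,
    inv_mul_cancel₀ (ENNReal.toReal_pos h0 hp).ne', ENNReal.rpow_one]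

theorem eLpNorm_sigmaMeasure_rpow (h0 : p ≠ 0) (hp : p ≠ ∞) (f : Sigma Ω → E) :
    eLpNorm f p (sigmaMeasure μ) ^ p.toReal =
      ∑' i, eLpNorm (fun x => f ⟨i, x⟩) p (μ i) ^ p.toReal := by
  simp_rw [eLpNorm_rpow_toReal h0 hp]
  rw [sigmaMeasure, lintegral_sum_measure]
  exact tsum_congr fun i => (measurableEmbedding_sigmaMk i).lintegral_map _

theorem memLp_sigmaMeasure_iff [Countable I] (h0 : p ≠ 0) (hp : p ≠ ∞) {f : Sigma Ω → E} :
    MemLp f p (sigmaMeasure μ) ↔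
      (∀ i, AEStronglyMeasurable (fun x => f ⟨i, x⟩) (μ i)) ∧
        ∑' i, eLpNorm (fun x => f ⟨i, x⟩) p (μ i) ^ p.toReal ≠ ∞ := by
  rw [MemLp, aestronglyMeasurable_sigmaMeasure_iff, ← eLpNorm_sigmaMeasure_rpow h0 hp,
    ← lt_top_iff_ne_top, ENNReal.rpow_lt_top_iff_of_pos (ENNReal.toReal_pos h0 hp)]

theorem memLp_sigmaMk [Countable I] (h0 : p ≠ 0) (hp : p ≠ ∞) {f : Sigma Ω → E}
    (hf : MemLp f p (sigmaMeasure μ)) (i : I) : MemLp (fun x => f ⟨i, x⟩) p (μ i) := by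
  rw [memLp_sigmaMeasure_iff h0 hp] at hf
  refine ⟨hf.1 i, ?_⟩
  rw [← ENNReal.rpow_lt_top_iff_of_pos (ENNReal.toReal_pos h0 hp)]
  exact (ENNReal.le_tsum i).trans_lt hf.2.lt_top

theorem norm_toLp_rpow {α : Type*} [MeasurableSpace α] {ν : Measure α} {g : α → E}
    (hg : MemLp g p ν) :
    ‖hg.toLp g‖ ^ p.toReal = (eLpNorm g p ν ^ p.toReal).toReal := by
  rw [Lp.norm_toLp, ENNReal.toReal_rpow]

variable [Fact (1 ≤ p)] (𝕜 : Type*) [RCLike 𝕜] [NormedSpace 𝕜 E]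

/-- A countable `ℓ^p`-sum of `L^p`-spaces is the `L^p`-space of the disjoint union. -/
theorem exists_lp_Lp_equiv_Lp_sigma [Countable I] (hp : p ≠ ∞) (μ : ∀ i, Measure (Ω i)) :
    Nonempty (lp (fun i => Lp E p (μ i)) p ≃ₗᵢ[𝕜] Lp E p (sigmaMeasure μ)) := by
  have h0 : p ≠ 0 := (zero_lt_one.trans_le (Fact.out : 1 ≤ p)).ne'
  have hpos : 0 < p.toReal := ENNReal.toReal_pos h0 hp
  have hmem : ∀ f : Lp E p (sigmaMeasure μ), ∀ i, MemLp (fun x => f ⟨i, x⟩) p (μ i) :=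
    fun f i => memLp_sigmaMk h0 hp (Lp.memLp f) i
  have hne : ∀ f : Lp E p (sigmaMeasure μ),
      ∑' i, eLpNorm (fun x => f ⟨i, x⟩) p (μ i) ^ p.toReal ≠ ∞ :=
    fun f => ((memLp_sigmaMeasure_iff h0 hp).1 (Lp.memLp f)).2
  let φ : Lp E p (sigmaMeasure μ) →ₗᵢ[𝕜] lp (fun i => Lp E p (μ i)) p :=
    { toFun := fun f => ⟨fun i => (hmem f i).toLp _, by
        refine (memℓp_gen_iff hpos).2 ?_
        simp_rw [norm_toLp_rpow]
        exact ENNReal.summable_toReal (hne f)⟩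
      map_add' := fun f g => by
        refine lp.ext (funext fun i => ?_)
        change (hmem (f + g) i).toLp _ = (hmem f i).toLp _ + (hmem g i).toLp _
        rw [← MemLp.toLp_add, MemLp.toLp_eq_toLp_iff]
        exact ae_sigmaMeasure_iff.1 (Lp.coeFn_add f g) i
      map_smul' := fun c f => by
        refine lp.ext (funext fun i => ?_)
        change (hmem (c • f) i).toLp _ = c • (hmem f i).toLp _
        rw [← MemLp.toLp_const_smul, MemLp.toLp_eq_toLp_iff]
        exact ae_sigmaMeasure_iff.1 (Lp.coeFn_smul c f) i
      norm_map' := fun f => by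
        refine (Real.rpow_left_inj (norm_nonneg _) (norm_nonneg _) hpos.ne').1 ?_
        rw [lp.norm_rpow_eq_tsum hpos]
        change ∑' i, ‖(hmem f i).toLp _‖ ^ p.toReal = _
        simp_rw [norm_toLp_rpow]
        rw [Lp.norm_def, ENNReal.toReal_rpow, eLpNorm_sigmaMeasure_rpow h0 hp,
          ENNReal.tsum_toReal_eq fun i => ENNReal.ne_top_of_tsum_ne_top (hne f) i] }
  -- A preimage is obtained by gluing representatives of the components; its `p`-th power integral
  -- is the convergent sum of theirs.
  have hsurj : Function.Surjective φ := by
    intro F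
    let f : Sigma Ω → E := fun x => F x.1 x.2
    have hf : MemLp f p (sigmaMeasure μ) := by
      refine (memLp_sigmaMeasure_iff h0 hp).2 ⟨fun i => (Lp.memLp (F i)).1, ?_⟩
      have h := (lp.memℓp F).summable hpos
      convert h.tsum_ofReal_ne_top using 3 with i
      rw [Lp.norm_def, ENNReal.toReal_rpow, ENNReal.ofReal_toReal]
      exact (ENNReal.rpow_lt_top_of_nonneg hpos.le (Lp.memLp (F i)).2.ne).ne
    refine ⟨hf.toLp f, lp.ext (funext fun i => ?_)⟩
    have h1 := ae_sigmaMeasure_iff.1 hf.coeFn_toLp i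
    exact Lp.ext ((MemLp.coeFn_toLp (hmem (hf.toLp f) i)).trans h1)
  exact ⟨(LinearIsometryEquiv.ofSurjective φ hsurj).symm⟩

end LpSigma

/-! ### Proper actions and the combination over all vertices -/

section Proper

variable {𝕜 : Type} [RCLike 𝕜]

/-- The discrete group `H` has a proper affine isometric action on a space in the class `P`: for
every `M`, only finitely many elements move the origin by at most `M`. -/
def HasProperActionIn (P : ∀ (E : Type w) [NormedAddCommGroup E] [NormedSpace 𝕜 E], Prop)
    (H : Type u) [Group H] : Prop :=
  ∃ (E : Type w) (_ : NormedAddCommGroup E) (_ : NormedSpace 𝕜 E), P E ∧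
    ∃ α : H →* (E ≃ᵃⁱ[𝕜] E), ∀ M : ℝ, {g | ‖α g 0‖ ≤ M}.Finite

/-- Countability of the vertex groups keeps all later index sets countable, as the closure property
of the class requires. -/
theorem HasProperActionIn.countable
    {P : ∀ (E : Type w) [NormedAddCommGroup E] [NormedSpace 𝕜 E], Prop}
    {H : Type u} [Group H] (h : HasProperActionIn P H) : Countable H := by
  obtain ⟨E, _, _, -, α, hα⟩ := h
  have h1 : (⋃ n : ℕ, {g | ‖α g 0‖ ≤ n}) = Set.univ :=
    Set.eq_univ_of_forall fun g => Set.mem_iUnion.2 (exists_nat_ge ‖α g 0‖)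
  rw [← Set.countable_univ_iff, ← h1]
  exact Set.countable_iUnion fun n => (hα n).countable

theorem exists_conj_affineAction {E F : Type*} [NormedAddCommGroup E] [NormedSpace 𝕜 E]
    [NormedAddCommGroup F] [NormedSpace 𝕜 F] (e : E ≃ₗᵢ[𝕜] F) {H : Type*} [Group H]
    (α : H →* (E ≃ᵃⁱ[𝕜] E)) :
    ∃ β : H →* (F ≃ᵃⁱ[𝕜] F), ∀ g, ‖β g 0‖ = ‖α g 0‖ := by
  refine ⟨MonoidHom.mk' (fun g => (e.symm.toAffineIsometryEquiv.trans (α g)).trans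
    e.toAffineIsometryEquiv) fun g h => ?_, fun g => ?_⟩
  · ext x
    simp
  · simp

theorem isProperAffineAction_of_finite {E : Type w} [NormedAddCommGroup E] [NormedSpace 𝕜 E]
    {H : Type u} [Group H] {α : H →* (E ≃ᵃⁱ[𝕜] E)} (hα : ∀ M : ℝ, {g | ‖α g 0‖ ≤ M}.Finite) :
    IsProperAffineAction α := by
  intro M _ x
  refine ⟨(hα (M + ‖x‖)).toFinset, fun g hg => ?_⟩
  have h1 : M + ‖x‖ < ‖α g 0‖ := by simpa using hg
  have h2 := norm_sub_norm_le_norm_affineAction α g x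
  linarith

theorem IsProperAffineAction.finite {E : Type w} [NormedAddCommGroup E] [NormedSpace 𝕜 E]
    {H : Type u} [Group H] {α : H →* (E ≃ᵃⁱ[𝕜] E)} (hα : IsProperAffineAction α) (M : ℝ) :
    {g | ‖α g 0‖ ≤ M}.Finite := by
  obtain ⟨F, hF⟩ := hα (|M| + 1) (by positivity) 0
  refine F.finite_toSet.subset fun g hg => ?_
  by_contra h
  have := hF g h
  have h1 : ‖α g 0‖ ≤ M := hg
  linarith [le_abs_self M]

/-- Only finitely many elements of a graph product have geodesic words satisfying uniform bounds
for suitable nonnegative weights of the letters: for each vertex `x`, one weight is proper on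
`G x`, and another one is bounded below on `G x` by a constant which tends to infinity with `x`. -/
theorem finite_of_weight_le {V : Type u} (Γ : SimpleGraph V) {G : V → Type v} [∀ x, Group (G x)]
    {f : V → ℕ} (hf : Function.Injective f) (c : V × Bool → (Σ x, G x) → ℝ)
    (hc : ∀ j s, 0 ≤ c j s) (hproper : ∀ x (N : ℝ), {a : G x | c (x, true) ⟨x, a⟩ ≤ N}.Finite)
    (hlarge : ∀ x (a : G x), a ≠ 1 → (f x : ℝ) + 1 ≤ c (x, false) ⟨x, a⟩) (N : ℝ) :
    {g : GraphProduct Γ G | ∀ l, GraphProduct.IsGeodesic Γ l → GraphProduct.wordProd Γ l = g →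
      ∀ j, (l.map (c j)).sum ≤ N}.Finite := by
  have hS : {x | (f x : ℝ) ≤ N}.Finite := by
    refine ((Set.finite_Iic ⌊N⌋₊).preimage hf.injOn).subset fun x hx => ?_
    exact Nat.le_floor hx
  have hT : (⋃ x ∈ {x | (f x : ℝ) ≤ N},
      (Sigma.mk x) '' {a : G x | c (x, true) ⟨x, a⟩ ≤ N}).Finite :=
    hS.biUnion fun x _ => (hproper x N).image _
  set T := ⋃ x ∈ {x | (f x : ℝ) ≤ N}, (Sigma.mk x) '' {a : G x | c (x, true) ⟨x, a⟩ ≤ N}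
  have : Finite T := hT
  refine ((List.finite_length_le T ⌊hS.toFinset.card • N⌋₊).image
    fun l => GraphProduct.wordProd Γ (l.map Subtype.val)).subset fun g hg => ?_
  obtain ⟨l, hl, rfl⟩ := GraphProduct.exists_isGeodesic g
  have hb : ∀ j, (l.map (c j)).sum ≤ N := hg l hl rfl
  have hletter : ∀ s ∈ l, ∀ j, c j s ≤ N := fun s hs j =>
    (List.single_le_sum (List.forall_mem_map.2 fun s _ => hc j s) _
      (List.mem_map_of_mem hs)).trans (hb j)
  have hfalse : ∀ s ∈ l, (f s.1 : ℝ) + 1 ≤ c (s.1, false) s := fun s hs =>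
    hlarge s.1 s.2 (hl.ne_one hs)
  have hlS : ∀ s ∈ l, s.1 ∈ hS.toFinset := by
    intro s hs
    have h1 := hletter s hs (s.1, false)
    have h2 := hfalse s hs
    simp only [Set.Finite.mem_toFinset, Set.mem_ofPred_eq]
    linarith
  have hlT : ∀ s ∈ l, s ∈ T := fun s hs =>
    Set.mem_biUnion (by simpa using hlS s hs) ⟨s.2, hletter s hs _, rfl⟩
  -- Each letter at `x` contributes at least `1` to the weight `(x, false)`, and each of the
  -- finitely many relevant weights totals at most `N`.
  have hlen : (l.length : ℝ) ≤ hS.toFinset.card • N := by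
    calc (l.length : ℝ) = l.length • (1 : ℝ) := by simp
      _ ≤ (l.map fun s => ∑ x ∈ hS.toFinset, c (x, false) s).sum := by
        rw [← List.length_map (fun s => ∑ x ∈ hS.toFinset, c (x, false) s)]
        refine List.card_nsmul_le_sum _ _ ?_
        simp only [List.mem_map, forall_exists_index, and_imp, forall_apply_eq_imp_iff₂]
        intro s hs
        refine le_trans ?_ (Finset.single_le_sum (fun x _ => hc (x, false) s) (hlS s hs))
        have := hfalse s hs
        have h0 : (0 : ℝ) ≤ f s.1 := Nat.cast_nonneg _
        linarith
      _ = ∑ x ∈ hS.toFinset, (l.map (c (x, false))).sum := by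
        clear hb hletter hfalse hlS hlT hl hg
        induction l with
        | nil => simp
        | cons s l ih => simp [ih, Finset.sum_add_distrib]
      _ ≤ hS.toFinset.card • N := Finset.sum_le_card_nsmul _ _ _ fun x _ => hb (x, false)
  lift l to List T using hlT
  exact ⟨l, by simpa using Nat.le_floor hlen, rfl⟩

variable {p : ℝ≥0∞} [Fact (1 ≤ p)]

/-- Let `P` be a class of spaces which is closed under countable `ℓ^p`-sums and contains a
nontrivial space. If the vertex groups have proper affine isometric actions on spaces in `P`, then
so does the graph product. -/
theorem HasProperActionIn.graphProduct (hp : p ≠ ∞)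
    {P : ∀ (E : Type w) [NormedAddCommGroup E] [NormedSpace 𝕜 E], Prop}
    (hP : ∀ (I : Type w) [Countable I] (E : I → Type w) [∀ i, NormedAddCommGroup (E i)]
      [∀ i, NormedSpace 𝕜 (E i)], (∀ i, P (E i)) → P (lp E p))
    (hL : ∃ (L : Type w) (_ : NormedAddCommGroup L) (_ : NormedSpace 𝕜 L), P L ∧ Nontrivial L)
    {V : Type u} [Countable V] (Γ : SimpleGraph V) {G : V → Type v} [∀ x, Group (G x)]
    (h : ∀ x, HasProperActionIn P (G x)) : HasProperActionIn P (GraphProduct Γ G) := by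
  have : ∀ x, Countable (G x) := fun x => (h x).countable
  obtain ⟨f, hf⟩ := exists_injective_nat V
  have hpos := toReal_pos_of_ne_top hp
  have hone : 1 ≤ p.toReal := by
    simpa using ENNReal.toReal_mono hp (Fact.out : 1 ≤ p)
  -- The given actions do not suffice: nontrivial elements may have small or zero displacement, so
  -- long words or infinitely many vertices could go unnoticed. The index `false` supplies the
  -- uniform lower bound.
  have hvertex : ∀ j : V × Bool, ∃ (E : Type w) (_ : NormedAddCommGroup E) (_ : NormedSpace 𝕜 E),
      P E ∧ ∃ α : G j.1 →* (E ≃ᵃⁱ[𝕜] E), (j.2 = true → ∀ M : ℝ, {g | ‖α g 0‖ ≤ M}.Finite) ∧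
        (j.2 = false → ∀ g, g ≠ 1 → (f j.1 : ℝ) + 1 ≤ ‖α g 0‖) := by
    rintro ⟨x, _ | _⟩
    · obtain ⟨L, _, _, hPL, _⟩ := hL
      obtain ⟨y, hy⟩ := NormedSpace.exists_lt_norm 𝕜 L ((f x : ℝ) + 1)
      -- `Shrink` moves the countable index set to the universe `w` in which `P` lives.
      obtain ⟨α, hα⟩ := exists_affineAction_norm_le 𝕜 hp (equivShrink.{w} (G x)).symm y
      have : Countable (Shrink.{w} (G x)) := (equivShrink.{w} (G x)).symm.injective.countable
      exact ⟨_, _, _, hP _ _ fun _ => hPL, α, by simp, fun _ g hg => hy.le.trans (hα g hg)⟩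
    · obtain ⟨E, _, _, hPE, α, hα⟩ := h x
      exact ⟨E, _, _, hPE, α, fun _ => hα, by simp⟩
  have hinduced : ∀ j : V × Bool, ∃ (E : Type w) (_ : NormedAddCommGroup E)
      (_ : NormedSpace 𝕜 E) (c : (Σ x, G x) → ℝ) (β : GraphProduct Γ G →* (E ≃ᵃⁱ[𝕜] E)),
      P E ∧ (∀ l, GraphProduct.IsGeodesic Γ l →
        ‖β (GraphProduct.wordProd Γ l) 0‖ ^ p.toReal = (l.map c).sum) ∧
      (∀ s, 0 ≤ c s) ∧ (∀ s, s.1 ≠ j.1 → c s = 0) ∧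
      (j.2 = true → ∀ N : ℝ, {a : G j.1 | c ⟨j.1, a⟩ ≤ N}.Finite) ∧
      (j.2 = false → ∀ a : G j.1, a ≠ 1 → (f j.1 : ℝ) + 1 ≤ c ⟨j.1, a⟩) := by
    intro j
    obtain ⟨E, _, _, hPE, α, h1, h2⟩ := hvertex j
    have : Countable (GraphProduct Γ G ⧸ GraphProduct.star Γ G j.1) :=
      Quotient.mk_surjective.countable
    obtain ⟨β, hβ⟩ := exists_inducedAction hp Γ j.1 α
      (equivShrink.{w} (GraphProduct Γ G ⧸ GraphProduct.star Γ G j.1)).symm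
    have : Countable (Shrink.{w} (GraphProduct Γ G ⧸ GraphProduct.star Γ G j.1)) :=
      (equivShrink.{w} (GraphProduct Γ G ⧸ GraphProduct.star Γ G j.1)).symm.injective.countable
    refine ⟨_, _, _, _, β, hP _ _ fun _ => hPE, hβ, fun s => by positivity, fun s hs => ?_,
      fun hj N => ?_, fun hj a ha => ?_⟩
    · rw [GraphProduct.proj_of_ne hs, map_one, AffineIsometryEquiv.coe_one, id, norm_zero,
        Real.zero_rpow hpos.ne']
    · refine (h1 hj (|N| ^ p.toReal⁻¹)).subset fun a ha => ?_
      have ha' : ‖α a 0‖ ^ p.toReal ≤ N := by simpa using ha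
      rw [Set.mem_ofPred_eq, Real.le_rpow_inv_iff_of_pos (norm_nonneg _) (abs_nonneg _) hpos]
      exact ha'.trans (le_abs_self N)
    · rw [GraphProduct.proj_of_self]
      -- The summand `1` makes the displacement at least `1`, so raising it to the power `p ≥ 1`
      -- preserves the lower bound.
      refine (h2 hj a ha).trans (Real.self_le_rpow_of_one_le ?_ hone)
      exact le_trans (by simp) (h2 hj a ha)
  choose E _ _ c β hPE hβ hc hc0 hproper hlarge using hinduced
  let e := (equivShrink.{w} (V × Bool)).symm
  have : Countable (Shrink.{w} (V × Bool)) := e.injective.countable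
  obtain ⟨B, hB⟩ := exists_affineAction_lp (p := p) (fun i => β (e i)) fun g => by
    -- A word involves finitely many vertices, and every other component of its displacement
    -- vanishes.
    refine Memℓp.of_exponent_ge (memℓp_zero ?_) bot_le
    obtain ⟨l, hl, rfl⟩ := GraphProduct.exists_isGeodesic g
    refine Set.Finite.preimage (s := {j | β j (GraphProduct.wordProd Γ l) 0 ≠ 0})
      e.injective.injOn ?_
    refine ((l.map Sigma.fst).finite_toSet.prod Set.finite_univ).subset fun j hj => ?_
    refine Set.mk_mem_prod ?_ (Set.mem_univ _)
    by_contra hn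
    refine hj ?_
    have h0 : (l.map (c j)).sum = 0 := by
      refine List.sum_eq_zero ?_
      simp only [List.mem_map, forall_exists_index, and_imp, forall_apply_eq_imp_iff₂]
      exact fun s hs => hc0 j s fun h => hn (List.mem_map.2 ⟨s, hs, h⟩)
    rw [← hβ j l hl, Real.rpow_eq_zero (norm_nonneg _) hpos.ne', norm_eq_zero] at h0
    exact h0
  refine ⟨_, _, _, hP _ (fun i => E (e i)) fun i => hPE (e i), B, fun M => ?_⟩
  refine (finite_of_weight_le Γ hf c hc (fun x => hproper (x, true) rfl)
    (fun x => hlarge (x, false) rfl) (|M| ^ p.toReal)).subset fun g hg l hl hlg j => ?_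
  subst hlg
  obtain ⟨i, rfl⟩ := e.surjective j
  rw [← hβ _ l hl]
  refine Real.rpow_le_rpow (norm_nonneg _) ?_ hpos.le
  rw [← hB]
  refine (lp.norm_apply_le_norm (zero_lt_one.trans_le (Fact.out : 1 ≤ p)).ne' _ i).trans ?_
  exact le_trans hg (le_abs_self M)

end Proper

/-! ### The classes of `L^p`-spaces and Hilbert spaces -/

section Classes

variable (𝕜 : Type) [RCLike 𝕜]

/-- The normed space is isometric to an `L^p`-space. -/
def IsLpSpace (p : ℝ≥0∞) [Fact (1 ≤ p)] (E : Type w) [NormedAddCommGroup E] [NormedSpace 𝕜 E] :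
    Prop :=
  ∃ (Ω : Type w) (_ : MeasurableSpace Ω) (μ : Measure Ω), Nonempty (E ≃ₗᵢ[𝕜] Lp 𝕜 p μ)

/-- The normed space is isometric to a Hilbert space. -/
def IsHilbertSpace (E : Type w) [NormedAddCommGroup E] [NormedSpace 𝕜 E] : Prop :=
  ∃ (H : Type w) (_ : NormedAddCommGroup H) (_ : InnerProductSpace 𝕜 H),
    CompleteSpace H ∧ Nonempty (E ≃ₗᵢ[𝕜] H)

variable {𝕜}

theorem isLpSpace_lp {p : ℝ≥0∞} [Fact (1 ≤ p)] (hp : p ≠ ∞) (I : Type w) [Countable I]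
    (E : I → Type w) [∀ i, NormedAddCommGroup (E i)] [∀ i, NormedSpace 𝕜 (E i)]
    (h : ∀ i, IsLpSpace 𝕜 p (E i)) : IsLpSpace 𝕜 p (lp E p) := by
  choose Ω _ μ e using h
  obtain ⟨φ⟩ := exists_lp_Lp_equiv_Lp_sigma (E := 𝕜) 𝕜 hp μ
  exact ⟨Sigma Ω, _, sigmaMeasure μ, ⟨(lpCongr fun i => (e i).some).trans φ⟩⟩

theorem exists_isLpSpace_nontrivial {p : ℝ≥0∞} [Fact (1 ≤ p)] (hp : p ≠ ∞) :
    ∃ (L : Type w) (_ : NormedAddCommGroup L) (_ : NormedSpace 𝕜 L),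
      IsLpSpace 𝕜 p L ∧ Nontrivial L := by
  refine ⟨Lp 𝕜 p (Measure.dirac PUnit.unit.{w + 1}), _, _,
    ⟨PUnit, _, _, ⟨LinearIsometryEquiv.refl 𝕜 _⟩⟩, ?_⟩
  refine ⟨indicatorConstLp p MeasurableSet.univ (measure_ne_top _ _) 1, 0, fun h => ?_⟩
  have h1 := congrArg norm h
  rw [norm_indicatorConstLp (zero_lt_one.trans_le (Fact.out : 1 ≤ p)).ne' hp] at h1
  simp at h1

theorem isHilbertSpace_lp (I : Type w) [Countable I]
    (E : I → Type w) [∀ i, NormedAddCommGroup (E i)] [∀ i, NormedSpace 𝕜 (E i)]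
    (h : ∀ i, IsHilbertSpace 𝕜 (E i)) : IsHilbertSpace 𝕜 (lp E 2) := by
  choose H _ _ _ e using h
  exact ⟨lp H 2, _, inferInstance, inferInstance, ⟨lpCongr fun i => (e i).some⟩⟩

theorem exists_isHilbertSpace_nontrivial :
    ∃ (L : Type w) (_ : NormedAddCommGroup L) (_ : NormedSpace 𝕜 L),
      IsHilbertSpace 𝕜 L ∧ Nontrivial L :=
  ⟨EuclideanSpace 𝕜 PUnit.{w + 1}, _, _,
    ⟨EuclideanSpace 𝕜 PUnit.{w + 1}, _, _, inferInstance, ⟨LinearIsometryEquiv.refl 𝕜 _⟩⟩,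
    inferInstance⟩

/-- An `ℓ^p`-sum of `L^p`-spaces is an `L^p`-space only up to isometry, so actions are transported
by conjugation. -/
theorem admitsProperAffineActionOnLp_iff {p : ℝ≥0∞} [Fact (1 ≤ p)] {H : Type u} [Group H] :
    AdmitsProperAffineActionOnLp.{u, w} 𝕜 p H ↔
      HasProperActionIn.{u, w}
        (fun E [NormedAddCommGroup E] [NormedSpace 𝕜 E] => IsLpSpace 𝕜 p E) H := by
  constructor
  · rintro ⟨Ω, _, μ, α, hα⟩
    exact ⟨Lp 𝕜 p μ, _, _, ⟨Ω, _, μ, ⟨LinearIsometryEquiv.refl 𝕜 _⟩⟩, α, hα.finite⟩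
  · rintro ⟨E, _, _, ⟨Ω, _, μ, ⟨e⟩⟩, α, hα⟩
    obtain ⟨β, hβ⟩ := exists_conj_affineAction e α
    exact ⟨Ω, _, μ, β, isProperAffineAction_of_finite (by simpa only [hβ] using hα)⟩

/-- Compact subsets of a discrete group are finite, and a proper action forces countability, hence
second countability. -/
theorem isHaagerup_iff {H : Type u} [Group H] [TopologicalSpace H] [DiscreteTopology H] :
    IsHaagerup.{u, w} 𝕜 H ↔
      HasProperActionIn.{u, w}
        (fun E [NormedAddCommGroup E] [NormedSpace 𝕜 E] => IsHilbertSpace 𝕜 E) H := by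
  constructor
  · rintro ⟨-, -, -, E, _, _, _, α, -, hα⟩
    refine ⟨E, _, _, ⟨E, _, _, ‹_›, ⟨LinearIsometryEquiv.refl 𝕜 _⟩⟩, α, fun M => ?_⟩
    obtain ⟨K, hK, h⟩ := hα (|M| + 1) (by positivity)
    refine hK.finite_of_discrete.subset fun g hg => ?_
    by_contra hn
    have h1 := h g hn
    have h2 : ‖α g 0‖ ≤ M := hg
    linarith [le_abs_self M]
  · intro h
    have := h.countable
    obtain ⟨E, _, _, ⟨F, _, _, _, ⟨e⟩⟩, α, hα⟩ := h
    obtain ⟨β, hβ⟩ := exists_conj_affineAction e α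
    refine ⟨inferInstance, inferInstance, inferInstance, F, _, _, ‹_›, β,
      fun x => continuous_of_discreteTopology, fun M _ => ?_⟩
    refine ⟨{g | ‖α g 0‖ ≤ M}, (hα M).isCompact, fun g hg => ?_⟩
    rw [hβ]
    exact (not_le.1 hg).le

/-- A proper affine isometric action restricts to any group mapping injectively. -/
theorem AdmitsProperAffineActionOnLp.of_injective {p : ℝ≥0∞} [Fact (1 ≤ p)] {H : Type u} [Group H]
    {K : Type v} [Group K] (φ : K →* H) (hφ : Function.Injective φ)
    (h : AdmitsProperAffineActionOnLp.{u, w} 𝕜 p H) :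
    AdmitsProperAffineActionOnLp.{v, w} 𝕜 p K := by
  obtain ⟨Ω, _, μ, α, hα⟩ := h
  refine ⟨Ω, _, μ, α.comp φ, fun M hM x => ?_⟩
  obtain ⟨F, hF⟩ := hα M hM x
  refine ⟨F.preimage φ hφ.injOn, fun g hg => hF (φ g) fun h => hg (by simpa using h)⟩

end Classes

theorem theorem3p4 (𝕜 : Type) [RCLike 𝕜] {V : Type u} [Countable V] (Γ : SimpleGraph V)
    (G : V → Type v) [∀ x, Group (G x)] [∀ x, TopologicalSpace (G x)]
    [∀ x, DiscreteTopology (G x)] [TopologicalSpace (GraphProduct Γ G)]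
    [DiscreteTopology (GraphProduct Γ G)] :
    (∀ (p : ℝ≥0∞) [Fact (1 ≤ p)], p ≠ ∞ →
      (AdmitsProperAffineActionOnLp.{max u v, w} 𝕜 p (GraphProduct Γ G) ↔
        ∀ x : V, AdmitsProperAffineActionOnLp.{v, w} 𝕜 p (G x))) ∧
    ((∀ x : V, IsHaagerup.{v, w} 𝕜 (G x)) →
      IsHaagerup.{max u v, w} 𝕜 (GraphProduct Γ G)) := by
  refine ⟨fun p _ hp => ⟨fun h x => h.of_injective _ (GraphProduct.of_injective x), fun h => ?_⟩,
    fun h => ?_⟩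
  · simp only [admitsProperAffineActionOnLp_iff] at h ⊢
    exact HasProperActionIn.graphProduct hp (isLpSpace_lp hp) (exists_isLpSpace_nontrivial hp) Γ h
  · simp only [isHaagerup_iff] at h ⊢
    exact HasProperActionIn.graphProduct ENNReal.ofNat_ne_top isHilbertSpace_lp
      exists_isHilbertSpace_nontrivial Γ h
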